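/- **Proposition (No-Go Theorem).** Let $M$ be a finite-dimensional smooth manifold with a smooth generalized Riemannian (that is, pseudo-Riemannian) metric $g$: a smooth field of nondegenerate symmetric bilinear forms on the tangent spaces $V_p$, of arbitrary signature, so that Riemannian and Lorentzian metrics are included. Suppose that the Riemann curvature tensor of $g$ is nonzero at some point $x\in M$, and let $M_x$ be the connected component of $M$ that contains $x$ (so $M_x=M$ if $M$ is connected). Consider parallel transport with respect to the Levi-Civita connection of $g$: a vector field $V$ along a smooth curve $\gamma$ is parallel if $\dot V^{\alpha}=-\Gamma^{\alpha}_{\mu\lambda}\dot\gamma^{\mu}V^{\lambda}$ in every coordinate system, and transport along a piecewise smooth path is the composition of the transports along its smooth pieces. Then: 1. for every piecewise smooth path $c$ in $M$ from $p$ to $q$, every $v\in V_p$ has exactly one parallel transport $P_c v\in V_q$ along $c$; 2. $M_x$ contains more than one point; 3. parallel transport depends on the path: for all $p,q\in M_x$ there are piecewise smooth paths $c,c'$ from $p$ to $q$ and a vector $v\in V_p$ with $P_c v\neq P_{c'}v$; 4. tangent vectors cannot be added independently of the choice of paths: for all $p,q,r\in M_x$ and every $v\in V_p$ there is a $w\in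 V_q$ such that the sum of $v$ and $w$, formed in $V_r$ as $P_\alpha v+P_\beta w$ with paths $\alpha$ from $p$ to $r$ and $\beta$ from $q$ to $r$, takes at least two different values as $\alpha$ and $\beta$ vary. -/

import Mathlib

open scoped Manifold ContDiff

/-- A smooth pseudo-Riemannian metric (a "generalized Riemannian metric") on a manifold `M` modelled
on the finite-dimensional space `E`: a smooth field of symmetric nondegenerate bilinear forms on the
tangent spaces.  No condition is put on the signature, so that Riemannian and Lorentzian metrics are
included. -/
structure PseudoRiemannianMetric (E : Type*) [NormedAddCommGroup E] [NormedSpace ℝ E]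
    (M : Type*) [TopologicalSpace M] [ChartedSpace E M] [IsManifold 𝓘(ℝ, E) ∞ M] where
  /-- The bilinear form on each tangent space. -/
  inner (x : M) :
    TangentSpace 𝓘(ℝ, E) x →L[ℝ] TangentSpace 𝓘(ℝ, E) x →L[ℝ] ℝ
  symm (x : M) (v w : TangentSpace 𝓘(ℝ, E) x) : inner x v w = inner x w v
  nondegenerate (x : M) (v : TangentSpace 𝓘(ℝ, E) x) (hv : ∀ w, inner x v w = 0) : v = 0
  contMDiff : ContMDiff 𝓘(ℝ, E) (𝓘(ℝ, E).prod 𝓘(ℝ, E →L[ℝ] E →L[ℝ] ℝ)) ∞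
    (fun x ↦ Bundle.TotalSpace.mk' (E →L[ℝ] E →L[ℝ] ℝ)
      (E := fun x : M ↦ TangentSpace 𝓘(ℝ, E) x →L[ℝ] TangentSpace 𝓘(ℝ, E) x →L[ℝ] ℝ)
      x (inner x))

/-- A smooth curve in `M` from `p` to `q`, parametrized by `[0, 1]`. -/
structure SmoothCurve (E : Type*) [NormedAddCommGroup E] [NormedSpace ℝ E]
    {M : Type*} [TopologicalSpace M] [ChartedSpace E M] (p q : M) where
  /-- The parametrization; only its values on `[0, 1]` matter. -/
  toFun : ℝ → M
  smooth : ContMDiffOn 𝓘(ℝ, ℝ) 𝓘(ℝ, E) ∞ toFun (Set.Icc 0 1)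
  source : toFun 0 = p
  target : toFun 1 = q

/-- A piecewise smooth path in `M` from `p` to `q`: a finite chain of smooth curves, each one
starting where the previous one ends (the empty chain is the constant path). -/
inductive PiecewiseSmoothPath (E : Type*) [NormedAddCommGroup E] [NormedSpace ℝ E]
    {M : Type*} [TopologicalSpace M] [ChartedSpace E M] : M → M → Type _ where
  | nil (p : M) : PiecewiseSmoothPath E p p
  | cons {p q r : M} (γ : SmoothCurve E p q) (c : PiecewiseSmoothPath E q r) :
      PiecewiseSmoothPath E p r

/-- The coordinates, in the chart `e`, of a tangent vector `v` at the point `x` of the domain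
of `e`. -/
noncomputable def chartCoord {E : Type*} [NormedAddCommGroup E] [NormedSpace ℝ E]
    {M : Type*} [TopologicalSpace M] [ChartedSpace E M]
    (e : OpenPartialHomeomorph M E) (x : M) (v : TangentSpace 𝓘(ℝ, E) x) : E :=
  mfderiv 𝓘(ℝ, E) 𝓘(ℝ, E) e x v

namespace PseudoRiemannianMetric

section Coordinates

variable {E : Type*} [NormedAddCommGroup E] [NormedSpace ℝ E]
  {M : Type*} [TopologicalSpace M] [ChartedSpace E M] [IsManifold 𝓘(ℝ, E) ∞ M]
  (g : PseudoRiemannianMetric E M)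

/-- The coordinate expression of the metric in the chart `e`, at the point `y` of the target of `e`:
the bilinear form `g_{αβ}(y)` on `E`. -/
noncomputable def chartMetric (e : OpenPartialHomeomorph M E) (y : E) : E →L[ℝ] E →L[ℝ] ℝ :=
  let A : E →L[ℝ] TangentSpace 𝓘(ℝ, E) (e.symm y) := mfderiv 𝓘(ℝ, E) 𝓘(ℝ, E) e.symm y
  (ContinuousLinearMap.precomp ℝ A) ∘L (g.inner (e.symm y) ∘L A)

/-- The Christoffel symbols `Γ(u, v)` of the Levi-Civita connection in the chart `e`: the vector
determined by
`g(Γ(u, v), w) = (∂_u g(v, w) + ∂_v g(u, w) - ∂_w g(u, v)) / 2` for all `w`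
(`inverse` raises the index; the metric is nondegenerate and `E` finite-dimensional). -/
noncomputable def christoffel (e : OpenPartialHomeomorph M E) (y u v : E) : E :=
  (g.chartMetric e y).inverse
    ((1 / 2 : ℝ) • (fderiv ℝ (g.chartMetric e) y u v + fderiv ℝ (g.chartMetric e) y v u
      - ((fderiv ℝ (g.chartMetric e) y).flip u).flip v))

/-- The coordinate expression of the Riemann curvature tensor in the chart `e`:
`R(u, v) w = ∂_u Γ(v, w) - ∂_v Γ(u, w) + Γ(u, Γ(v, w)) - Γ(v, Γ(u, w))`. -/
noncomputable def chartRiemann (e : OpenPartialHomeomorph M E) (y u v w : E) : E :=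
  fderiv ℝ (fun z ↦ g.christoffel e z v w) y u - fderiv ℝ (fun z ↦ g.christoffel e z u w) y v
    + g.christoffel e y u (g.christoffel e y v w) - g.christoffel e y v (g.christoffel e y u w)

/-- The Riemann curvature tensor `R(u, v) w` at the point `x`, given by its coordinates in the
preferred chart at `x`. -/
noncomputable def riemann (x : M) (u v w : TangentSpace 𝓘(ℝ, E) x) : E :=
  let e := chartAt E x
  g.chartRiemann e (e x) (chartCoord e x u) (chartCoord e x v) (chartCoord e x w)

/-- The vector field `V` along the curve `γ : [0, 1] → M` is parallel for the Levi-Civita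
connection: at each time `t`, and in each smooth chart `e` around `γ t`, its coordinates satisfy
`dV/dt = - Γ(dγ/dt, V)`. -/
def IsParallelAlong (γ : ℝ → M) (V : ∀ t, TangentSpace 𝓘(ℝ, E) (γ t)) : Prop :=
  ∀ t ∈ Set.Icc (0 : ℝ) 1, ∀ e ∈ IsManifold.maximalAtlas 𝓘(ℝ, E) ∞ M, γ t ∈ e.source →
    HasDerivWithinAt (fun s ↦ chartCoord e (γ s) (V s))
      (-(g.christoffel e (e (γ t)) (derivWithin (fun s ↦ e (γ s)) (Set.Icc 0 1) t)
        (chartCoord e (γ t) (V t))))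
      (Set.Icc 0 1) t

/-- `w` is the parallel transport of `v` along the smooth curve `γ`.  The end values of the parallel
field are compared with `v` and `w` as elements of the tangent bundle. -/
def IsCurveTransport {p q : M} (γ : SmoothCurve E p q)
    (v : TangentSpace 𝓘(ℝ, E) p) (w : TangentSpace 𝓘(ℝ, E) q) : Prop :=
  ∃ V : ∀ t, TangentSpace 𝓘(ℝ, E) (γ.toFun t), g.IsParallelAlong γ.toFun V ∧
    (⟨γ.toFun 0, V 0⟩ : TangentBundle 𝓘(ℝ, E) M) = ⟨p, v⟩ ∧
    (⟨γ.toFun 1, V 1⟩ : TangentBundle 𝓘(ℝ, E) M) = ⟨q, w⟩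

/-- `w` is the parallel transport of `v` along the piecewise smooth path `c`. -/
def IsParallelTransport {p q : M} (c : PiecewiseSmoothPath E p q)
    (v : TangentSpace 𝓘(ℝ, E) p) (w : TangentSpace 𝓘(ℝ, E) q) : Prop :=
  match c with
  | .nil _ => v = w
  | .cons (q := m) γ c => ∃ u : TangentSpace 𝓘(ℝ, E) m,
      g.IsCurveTransport γ v u ∧ IsParallelTransport c u w

/-- `s` is a sum, formed in the tangent space at `r`, of the tangent vectors `v` at `p` and `w`
at `q`: `s` is the sum of vectors obtained by parallel transport of `v` along some path
from `p` to `r` and of `w` along some path from `q` to `r`. -/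
def IsTransportedSum {p q r : M} (v : TangentSpace 𝓘(ℝ, E) p) (w : TangentSpace 𝓘(ℝ, E) q)
    (s : TangentSpace 𝓘(ℝ, E) r) : Prop :=
  ∃ (α : PiecewiseSmoothPath E p r) (β : PiecewiseSmoothPath E q r)
    (v' w' : TangentSpace 𝓘(ℝ, E) r),
    g.IsParallelTransport α v v' ∧ g.IsParallelTransport β w w' ∧ s = v' + w'

end Coordinates

end PseudoRiemannianMetric

/-! Suppose that transport around every loop at `x` were trivial. Carry a vector `c` at `x` along
coordinate segments to all points of a coordinate ball, obtaining a field `W`. Triviality around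
triangles with a vertex at `x` makes `W` invariant under transport along every segment in the ball.
A Grönwall estimate then gives `DW = -Γ(·, W)` (`hasFDerivAt_of_segment_transport`). Hence `W` has a
second derivative, and its symmetry says `R(u, v) W = 0`
(`curvature_apply_eq_zero_of_segment_transport`). At `x` this reads `R(u, v) c = 0` with `c`
arbitrary.

So nonzero curvature yields a loop at `x` that moves some vector. Inserting this loop into a path
from `p` to `q` through `x` changes the transport, and such paths exist throughout the component.
For sums, only the path of the second summand is varied.

Transport itself comes from a linear ODE in charts, solved on short pieces and glued. The
transformation law `christoffel_change` makes the equation independent of the chart. -/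

section Transport

open Set Filter Topology

/-! ### Linear ordinary differential equations -/

section LinearODE

variable {E : Type*} [NormedAddCommGroup E] [NormedSpace ℝ E]

/-- Picard–Lindelöf on the ball of radius `‖x₀‖` about `x₀`, where the right-hand side is at most `2
* C * ‖x₀‖`. By linearity the admissible length depends on `C` only, not on `x₀`. -/
theorem exists_hasDerivWithinAt_linear [CompleteSpace E] {A : ℝ → E →L[ℝ] E} {a b C : ℝ}
    (hab : a ≤ b) (hC : 0 ≤ C) (hA : ContinuousOn A (Icc a b)) (hAC : ∀ t ∈ Icc a b, ‖A t‖ ≤ C)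
    (h : 2 * C * (b - a) ≤ 1) (x₀ : E) :
    ∃ ξ : ℝ → E, ξ a = x₀ ∧ ∀ t ∈ Icc a b, HasDerivWithinAt ξ (A t (ξ t)) (Icc a b) t := by
  have hpl : IsPicardLindelof (fun t x ↦ A t x) (⟨a, left_mem_Icc.2 hab⟩ : Icc a b) x₀ ‖x₀‖₊ 0
      (2 * ⟨C, hC⟩ * ‖x₀‖₊) ⟨C, hC⟩ := by
    refine ⟨fun t ht ↦ ?_, fun x _ ↦ hA.clm_apply continuousOn_const, fun t ht x hx ↦ ?_, ?_⟩
    · exact ((A t).lipschitz.weaken (hAC t ht)).lipschitzOnWith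
    · have hx' : ‖x‖ ≤ 2 * ‖x₀‖ := by
        have := norm_le_of_mem_closedBall hx
        simp only [coe_nnnorm] at this
        linarith
      calc ‖A t x‖ ≤ ‖A t‖ * ‖x‖ := (A t).le_opNorm x
        _ ≤ C * (2 * ‖x₀‖) := by gcongr; exact hAC t ht
        _ = _ := by push_cast; change _ = 2 * C * ‖x₀‖; ring
    · have h0 : (0 : ℝ) ≤ b - a := by linarith
      have : (((2 * ⟨C, hC⟩ * ‖x₀‖₊ : NNReal)) : ℝ) = 2 * C * ‖x₀‖ := by push_cast; rfl
      rw [this]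
      simp only [sub_self, max_eq_left h0, coe_nnnorm, NNReal.coe_zero, sub_zero]
      nlinarith [norm_nonneg x₀]
  exact hpl.exists_eq_forall_mem_Icc_hasDerivWithinAt₀

theorem hasDerivWithinAt_Ici_of_Icc {f : ℝ → E} {f' : E} {a b t : ℝ} (ht : t ∈ Ico a b)
    (h : HasDerivWithinAt f f' (Icc a b) t) : HasDerivWithinAt f f' (Ici t) t :=
  h.mono_of_mem_nhdsWithin (Icc_mem_nhdsGE_of_mem ht)

theorem eqOn_of_hasDerivWithinAt_linear {A : ℝ → E →L[ℝ] E} {a b C : ℝ}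
    (hAC : ∀ t ∈ Icc a b, ‖A t‖ ≤ C) {ξ η : ℝ → E} (h0 : ξ a = η a)
    (hξ : ∀ t ∈ Icc a b, HasDerivWithinAt ξ (A t (ξ t)) (Icc a b) t)
    (hη : ∀ t ∈ Icc a b, HasDerivWithinAt η (A t (η t)) (Icc a b) t) :
    EqOn ξ η (Icc a b) := by
  intro t ht
  have hd : ∀ t ∈ Icc a b, HasDerivWithinAt (ξ - η) (A t ((ξ - η) t)) (Icc a b) t := by
    intro t ht
    have := (hξ t ht).sub (hη t ht)
    rwa [← map_sub] at this
  have := eq_zero_of_abs_deriv_le_mul_abs_self_of_eq_zero_right (f := ξ - η) (K := C)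
    (f' := fun t ↦ A t ((ξ - η) t)) (fun t ht ↦ (hd t ht).continuousWithinAt)
    (fun t ht ↦ hasDerivWithinAt_Ici_of_Icc ht (hd t (Ico_subset_Icc_self ht)))
    (by simp [h0])
    (fun t ht ↦ ((A t).le_opNorm _).trans
      (by gcongr; exact hAC t (Ico_subset_Icc_self ht))) t ht
  exact sub_eq_zero.1 this

theorem norm_le_of_hasDerivWithinAt_linear {A : ℝ → E →L[ℝ] E} {C : ℝ}
    (hAC : ∀ t ∈ Icc (0 : ℝ) 1, ‖A t‖ ≤ C) {ξ : ℝ → E}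
    (hξ : ∀ t ∈ Icc (0 : ℝ) 1, HasDerivWithinAt ξ (A t (ξ t)) (Icc 0 1) t) :
    ∀ t ∈ Icc (0 : ℝ) 1, ‖ξ t‖ ≤ ‖ξ 0‖ * Real.exp C := by
  intro t ht
  have hC : 0 ≤ C := (norm_nonneg _).trans (hAC 0 (by simp))
  have := norm_le_gronwallBound_of_norm_deriv_right_le (f := ξ) (K := C) (ε := 0)
    (f' := fun t ↦ A t (ξ t)) (fun t ht ↦ (hξ t ht).continuousWithinAt)
    (fun t ht ↦ hasDerivWithinAt_Ici_of_Icc ht (hξ t (Ico_subset_Icc_self ht)))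
    le_rfl
    (fun t ht ↦ ((A t).le_opNorm _).trans
      (by rw [add_zero]; gcongr; exact hAC t (Ico_subset_Icc_self ht))) t ht
  rw [gronwallBound_ε0, sub_zero] at this
  refine this.trans ?_
  gcongr
  nlinarith [ht.1, ht.2]

end LinearODE

/-! ### Covariantly constant fields and curvature on open sets of `E` -/

section FlatTransport

variable {E : Type*} [NormedAddCommGroup E] [NormedSpace ℝ E]

/-- If `W` is carried to itself along every segment in `s` by the transport of the connection `Γ`,
then `W` is covariantly constant in `s`. -/
theorem hasFDerivAt_of_segment_transport {Γ : E → E →L[ℝ] E →L[ℝ] E} {W : E → E} {s : Set E}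
    (hs : IsOpen s) (hΓ : ContinuousOn Γ s)
    (hW : ∀ y ∈ s, ∀ z ∈ s, ∃ ξ : ℝ → E, ξ 0 = W y ∧ ξ 1 = W z ∧ ∀ t ∈ Icc (0 : ℝ) 1,
      HasDerivWithinAt ξ (-(Γ (y + t • (z - y)) (z - y) (ξ t))) (Icc 0 1) t)
    {y : E} (hy : y ∈ s) : HasFDerivAt W (-(Γ y).flip (W y)) y := by
  refine .of_isLittleO (Asymptotics.isLittleO_iff.2 fun c hc ↦ ?_)
  set C := ‖Γ y‖ + 1
  have hC : 0 < C := by positivity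
  set K := ‖W y‖ * Real.exp C
  have hK : 0 ≤ K := by positivity
  obtain ⟨δ₁, hδ₁, hball₁⟩ := Metric.isOpen_iff.1 hs y hy
  -- The error `c` is split in halves: `ε * K ≤ c / 2` pays for the oscillation of `Γ`, and the
  -- choice of `δ` below gives `C * C * K * ‖h‖ ≤ c / 2` for the drift of `ξ` away from `W y`.
  set ε := min 1 (c / (2 * (K + 1)))
  have hε : 0 < ε := by positivity
  have hε1 : ε ≤ 1 := min_le_left _ _
  have hεK : ε * K ≤ c / 2 := by
    have h1 : ε ≤ c / (2 * (K + 1)) := min_le_right _ _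
    rw [le_div_iff₀ (by positivity)] at h1
    nlinarith
  obtain ⟨δ₂, hδ₂, hball₂⟩ : ∃ δ₂ > 0, ∀ ⦃z⦄, dist z y < δ₂ → dist (Γ z) (Γ y) < ε := by
    have hΓy : ContinuousAt Γ y := hΓ.continuousAt (hs.mem_nhds hy)
    exact Metric.eventually_nhds_iff.1 (hΓy.eventually (Metric.ball_mem_nhds (Γ y) hε))
  set δ := min (min δ₁ δ₂) (min 1 (c / (2 * (C * C * K + 1))))
  have hδ : 0 < δ := by positivity
  filter_upwards [Metric.ball_mem_nhds y hδ] with z hz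
  rw [Metric.mem_ball, dist_eq_norm] at hz
  have hz1 : ‖z - y‖ < δ₁ := hz.trans_le ((min_le_left _ _).trans (min_le_left _ _))
  have hz2 : ‖z - y‖ < δ₂ := hz.trans_le ((min_le_left _ _).trans (min_le_right _ _))
  have hz3 : ‖z - y‖ ≤ 1 := (hz.trans_le ((min_le_right _ _).trans (min_le_left _ _))).le
  have hz4 : C * C * K * ‖z - y‖ ≤ c / 2 := by
    have h1 : ‖z - y‖ ≤ c / (2 * (C * C * K + 1)) :=
      (hz.trans_le ((min_le_right _ _).trans (min_le_right _ _))).le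
    rw [le_div_iff₀ (by positivity)] at h1
    nlinarith [norm_nonneg (z - y)]
  obtain ⟨ξ, hξ0, hξ1, hξ⟩ := hW y hy z (hball₁ (by rwa [Metric.mem_ball, dist_eq_norm]))
  set h := z - y with hh
  have hΓt : ∀ t ∈ Icc (0 : ℝ) 1, ‖Γ (y + t • h) - Γ y‖ ≤ ε := by
    intro t ht
    refine (dist_eq_norm (Γ (y + t • h)) (Γ y)).symm.trans_le (hball₂ ?_).le
    rw [dist_eq_norm, add_sub_cancel_left, norm_smul, Real.norm_of_nonneg ht.1]
    nlinarith [ht.2, norm_nonneg h]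
  have hΓC : ∀ t ∈ Icc (0 : ℝ) 1, ‖Γ (y + t • h)‖ ≤ C := by
    intro t ht
    calc ‖Γ (y + t • h)‖ = ‖Γ y + (Γ (y + t • h) - Γ y)‖ := by rw [add_sub_cancel]
      _ ≤ ‖Γ y‖ + ‖Γ (y + t • h) - Γ y‖ := norm_add_le (Γ y) (Γ (y + t • h) - Γ y)
      _ ≤ C := by linarith [hΓt t ht]
  have hΓh : ∀ t ∈ Icc (0 : ℝ) 1, ‖-(Γ (y + t • h) h)‖ ≤ C * ‖h‖ := by
    intro t ht
    rw [norm_neg]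
    exact (ContinuousLinearMap.le_opNorm _ _).trans (by gcongr; exact hΓC t ht)
  have hξK : ∀ t ∈ Icc (0 : ℝ) 1, ‖ξ t‖ ≤ K := by
    have := norm_le_of_hasDerivWithinAt_linear (A := fun t ↦ -(Γ (y + t • h) h)) (C := C)
      (fun t ht ↦ (hΓh t ht).trans (by nlinarith)) (ξ := ξ) hξ
    rwa [hξ0] at this
  have hξW : ∀ t ∈ Icc (0 : ℝ) 1, ‖ξ t - W y‖ ≤ C * ‖h‖ * K := by
    intro t ht
    have := norm_image_sub_le_of_norm_deriv_le_segment' (f := ξ) (C := C * ‖h‖ * K) hξ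
      (fun t ht ↦ ?_) t ht
    · rw [hξ0] at this
      refine this.trans ?_
      have : 0 ≤ C * ‖h‖ * K := by positivity
      nlinarith [ht.1, ht.2]
    · have ht' := Ico_subset_Icc_self ht
      rw [← neg_apply]
      exact (ContinuousLinearMap.le_opNorm _ _).trans
        (mul_le_mul (hΓh t ht') (hξK t ht') (norm_nonneg _) (by positivity))
  -- The increment of this curve over `[0, 1]` is exactly the remainder `W z - W y + Γ y h (W y)`,
  -- so the mean value inequality reduces the claim to a bound of order `c * ‖h‖` on its derivative.
  have hη : ∀ t ∈ Icc (0 : ℝ) 1, HasDerivWithinAt (fun t ↦ ξ t + t • Γ y h (W y))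
      (-(Γ (y + t • h) h (ξ t)) + (1 : ℝ) • Γ y h (W y)) (Icc 0 1) t := fun t ht ↦
    (hξ t ht).add ((hasDerivWithinAt_id t _).smul_const _)
  have key := norm_image_sub_le_of_norm_deriv_le_segment_01' (C := c * ‖h‖) hη fun t ht ↦ ?_
  · simpa [hξ0, hξ1, sub_eq_add_neg, add_assoc, add_comm, add_left_comm, ← hh] using! key
  · have ht' := Ico_subset_Icc_self ht
    have e : -(Γ (y + t • h) h (ξ t)) + (1 : ℝ) • Γ y h (W y)
        = -((Γ (y + t • h) - Γ y) h (ξ t)) - Γ y h (ξ t - W y) := by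
      simp only [sub_apply, map_sub, one_smul]; abel
    rw [e]
    have b1 : ‖(Γ (y + t • h) - Γ y) h (ξ t)‖ ≤ ε * ‖h‖ * K :=
      (ContinuousLinearMap.le_opNorm₂ _ _ _).trans
        (by gcongr; exacts [hΓt t ht', hξK t ht'])
    have b2 : ‖Γ y h (ξ t - W y)‖ ≤ C * ‖h‖ * (C * ‖h‖ * K) :=
      (ContinuousLinearMap.le_opNorm₂ _ _ _).trans
        (by gcongr; exacts [by linarith, hξW t ht'])
    calc _ ≤ ‖-((Γ (y + t • h) - Γ y) h (ξ t))‖ + ‖Γ y h (ξ t - W y)‖ := norm_sub_le _ _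
      _ ≤ ε * ‖h‖ * K + C * ‖h‖ * (C * ‖h‖ * K) := by rw [norm_neg]; gcongr
      _ = (ε * K + C * C * K * ‖h‖) * ‖h‖ := by ring
      _ ≤ (c / 2 + c / 2) * ‖h‖ := by gcongr
      _ = c * ‖h‖ := by ring

/-- The curvature of a connection annihilates the values of its covariantly constant fields. -/
theorem curvature_apply_eq_zero_of_segment_transport {Γ : E → E →L[ℝ] E →L[ℝ] E} {W : E → E}
    {s : Set E} (hs : IsOpen s) (hΓ : ContinuousOn Γ s)
    (hW : ∀ y ∈ s, ∀ z ∈ s, ∃ ξ : ℝ → E, ξ 0 = W y ∧ ξ 1 = W z ∧ ∀ t ∈ Icc (0 : ℝ) 1,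
      HasDerivWithinAt ξ (-(Γ (y + t • (z - y)) (z - y) (ξ t))) (Icc 0 1) t)
    {y : E} (hy : y ∈ s) {Γ' : E →L[ℝ] E →L[ℝ] E →L[ℝ] E} (hΓ' : HasFDerivAt Γ Γ' y) (u v : E) :
    Γ' u v (W y) - Γ' v u (W y) + Γ y u (Γ y v (W y)) - Γ y v (Γ y u (W y)) = 0 := by
  have hd : ∀ z ∈ s, HasFDerivAt W (-(Γ z).flip (W z)) z := fun z hz ↦
    hasFDerivAt_of_segment_transport hs hΓ hW hz
  have hflip : HasFDerivAt (fun z ↦ (Γ z).flip)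
      (((ContinuousLinearMap.flipₗᵢ ℝ E E E).toContinuousLinearEquiv :
        (E →L[ℝ] E →L[ℝ] E) →L[ℝ] (E →L[ℝ] E →L[ℝ] E)).comp Γ') y :=
    ((ContinuousLinearMap.flipₗᵢ ℝ E E E).toContinuousLinearEquiv :
        (E →L[ℝ] E →L[ℝ] E) →L[ℝ] (E →L[ℝ] E →L[ℝ] E)).hasFDerivAt.comp y hΓ'
  -- The formula for `DW` holds on all of `s`, so the product rule differentiates it once more at
  -- `y`. Symmetry of the result, with `DW` substituted, is the curvature identity.
  have h2 := (hflip.clm_apply (hd y hy)).neg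
  have := second_derivative_symmetric_of_eventually
    (by filter_upwards [hs.mem_nhds hy] with z hz using hd z hz) h2 u v
  simp only [neg_apply, add_apply,
    ContinuousLinearMap.comp_apply, ContinuousLinearMap.flip_apply, map_neg,
    ContinuousLinearEquiv.coe_coe, LinearIsometryEquiv.coe_toContinuousLinearEquiv,
    ContinuousLinearMap.coe_flipₗᵢ] at this
  rw [← sub_eq_zero] at this
  rw [← neg_eq_zero, ← this]
  abel

end FlatTransport

/-! ### Tangent vectors in charts -/

section Charts

variable {E : Type*} [NormedAddCommGroup E] [NormedSpace ℝ E]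
  {M : Type*} [TopologicalSpace M] [ChartedSpace E M]
  {e e' : OpenPartialHomeomorph M E}

theorem OpenPartialHomeomorph.mdifferentiable_of_mem_maximalAtlas
    (he : e ∈ IsManifold.maximalAtlas 𝓘(ℝ, E) ∞ M) : e.MDifferentiable 𝓘(ℝ, E) 𝓘(ℝ, E) :=
  ⟨(contMDiffOn_of_mem_maximalAtlas he).mdifferentiableOn (by simp),
    (contMDiffOn_symm_of_mem_maximalAtlas he).mdifferentiableOn (by simp)⟩

theorem contDiffOn_transition (he : e ∈ IsManifold.maximalAtlas 𝓘(ℝ, E) ∞ M)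
    (he' : e' ∈ IsManifold.maximalAtlas 𝓘(ℝ, E) ∞ M) :
    ContDiffOn ℝ ∞ (fun y ↦ e' (e.symm y)) (e.target ∩ e.symm ⁻¹' e'.source) :=
  ((contMDiffOn_of_mem_maximalAtlas he').comp
    ((contMDiffOn_symm_of_mem_maximalAtlas he).mono inter_subset_left)
    fun _ hy ↦ hy.2).contDiffOn

/-- The tangent vector at the point with coordinates `y` in the chart `e`, given by its coordinates
in this chart. -/
noncomputable def chartVector (e : OpenPartialHomeomorph M E) (y : E) :
    E →L[ℝ] TangentSpace 𝓘(ℝ, E) (e.symm y) :=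
  mfderiv 𝓘(ℝ, E) 𝓘(ℝ, E) e.symm y

theorem chartCoord_chartVector (he : e ∈ IsManifold.maximalAtlas 𝓘(ℝ, E) ∞ M) {y : E}
    (hy : y ∈ e.target) (v : E) : chartCoord e (e.symm y) (chartVector e y v) = v :=
  DFunLike.congr_fun
    ((OpenPartialHomeomorph.mdifferentiable_of_mem_maximalAtlas he).comp_symm_deriv hy) v

theorem chartCoord_injective (he : e ∈ IsManifold.maximalAtlas 𝓘(ℝ, E) ∞ M) {x : M}
    (hx : x ∈ e.source) : Function.Injective (chartCoord e x) :=
  (OpenPartialHomeomorph.mdifferentiable_of_mem_maximalAtlas he).mfderiv_injective hx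

theorem chartVector_chartCoord (he : e ∈ IsManifold.maximalAtlas 𝓘(ℝ, E) ∞ M) {y : E}
    (hy : y ∈ e.target) (v : TangentSpace 𝓘(ℝ, E) (e.symm y)) :
    chartVector e y (chartCoord e (e.symm y) v) = v :=
  chartCoord_injective he (e.map_target hy) (chartCoord_chartVector he hy _)

theorem chartCoord_surjective (he : e ∈ IsManifold.maximalAtlas 𝓘(ℝ, E) ∞ M) {x : M}
    (hx : x ∈ e.source) : Function.Surjective (chartCoord e x) :=
  (OpenPartialHomeomorph.mdifferentiable_of_mem_maximalAtlas he).mfderiv_surjective hx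

theorem chartCoord_change (he : e ∈ IsManifold.maximalAtlas 𝓘(ℝ, E) ∞ M)
    (he' : e' ∈ IsManifold.maximalAtlas 𝓘(ℝ, E) ∞ M) {x : M} (hx : x ∈ e.source)
    (hx' : x ∈ e'.source) (v : TangentSpace 𝓘(ℝ, E) x) :
    chartCoord e' x v = fderiv ℝ (fun y ↦ e' (e.symm y)) (e x) (chartCoord e x v) := by
  have h1 := (OpenPartialHomeomorph.mdifferentiable_of_mem_maximalAtlas he).mdifferentiableAt hx
  have h2 : MDifferentiableAt 𝓘(ℝ, E) 𝓘(ℝ, E) (fun y ↦ e' (e.symm y)) (e x) :=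
    (((contDiffOn_transition he he').contDiffAt
      ((e.isOpen_inter_preimage_symm e'.open_source).mem_nhds
        ⟨e.map_source hx, by simpa [e.left_inv hx]⟩)).differentiableAt
        (by simp)).mdifferentiableAt
  have h3 := mfderiv_comp x h2 h1
  rw [mfderiv_eq_fderiv] at h3
  have h4 : mfderiv 𝓘(ℝ, E) 𝓘(ℝ, E) e' x
      = mfderiv 𝓘(ℝ, E) 𝓘(ℝ, E) ((fun y ↦ e' (e.symm y)) ∘ e) x := by
    apply Filter.EventuallyEq.mfderiv_eq
    filter_upwards [e.open_source.mem_nhds hx] with z hz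
    simp [e.left_inv hz]
  exact DFunLike.congr_fun (h4.trans h3) v

end Charts

/-! ### The metric in coordinates -/

namespace PseudoRiemannianMetric

variable {E : Type*} [NormedAddCommGroup E] [NormedSpace ℝ E]
  {M : Type*} [TopologicalSpace M] [ChartedSpace E M] [IsManifold 𝓘(ℝ, E) ∞ M]
  (g : PseudoRiemannianMetric E M) {e e' : OpenPartialHomeomorph M E}

theorem chartMetric_apply (e : OpenPartialHomeomorph M E) (y u v : E) :
    g.chartMetric e y u v = g.inner (e.symm y) (chartVector e y u) (chartVector e y v) :=
  rfl

theorem chartMetric_symm (e : OpenPartialHomeomorph M E) (y u v : E) :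
    g.chartMetric e y u v = g.chartMetric e y v u :=
  g.symm _ _ _

theorem eq_zero_of_chartMetric (he : e ∈ IsManifold.maximalAtlas 𝓘(ℝ, E) ∞ M) {y : E}
    (hy : y ∈ e.target) {u : E} (hu : ∀ v, g.chartMetric e y u v = 0) : u = 0 := by
  have h : chartVector e y u = 0 := g.nondegenerate _ _ fun w ↦ by
    rw [← chartVector_chartCoord he hy w]
    exact hu _
  rw [← chartCoord_chartVector he hy u, h]
  exact map_zero (mfderiv 𝓘(ℝ, E) 𝓘(ℝ, E) e (e.symm y))

theorem chartMetric_change (he : e ∈ IsManifold.maximalAtlas 𝓘(ℝ, E) ∞ M)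
    (he' : e' ∈ IsManifold.maximalAtlas 𝓘(ℝ, E) ∞ M) {y : E} (hy : y ∈ e.target)
    (hy' : e.symm y ∈ e'.source) (u v : E) :
    g.chartMetric e y u v = g.chartMetric e' (e' (e.symm y))
      (fderiv ℝ (fun y ↦ e' (e.symm y)) y u) (fderiv ℝ (fun y ↦ e' (e.symm y)) y v) := by
  have key : ∀ u, chartCoord e' (e.symm y) (chartVector e y u)
      = fderiv ℝ (fun y ↦ e' (e.symm y)) y u := by
    intro u
    rw [chartCoord_change he he' (e.map_target hy) hy', chartCoord_chartVector he hy,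
      e.right_inv hy]
  have aux : ∀ x ∈ e'.source, ∀ a b : TangentSpace 𝓘(ℝ, E) x,
      g.inner x a b = g.chartMetric e' (e' x) (chartCoord e' x a) (chartCoord e' x b) := by
    intro x hx
    obtain ⟨z, hz, rfl⟩ : ∃ z ∈ e'.target, e'.symm z = x := ⟨e' x, e'.map_source hx, e'.left_inv hx⟩
    intro a b
    rw [e'.right_inv hz, chartMetric_apply, chartVector_chartCoord he' hz,
      chartVector_chartCoord he' hz]
  rw [chartMetric_apply, aux _ hy', key, key]

/-- In finite dimension smoothness can be tested on fixed vectors `u`, `v`. Their images under the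
tangent map of `e.symm` are smooth fields along `e.symm`, to which the smooth metric is applied. -/
theorem contDiffOn_chartMetric [FiniteDimensional ℝ E]
    (he : e ∈ IsManifold.maximalAtlas 𝓘(ℝ, E) ∞ M) :
    ContDiffOn ℝ ∞ (g.chartMetric e) e.target := by
  have : IsManifold 𝓘(ℝ, E) 1 M := .of_le (n := ∞) (by simp)
  refine contDiffOn_clm_apply.2 fun u ↦ contDiffOn_clm_apply.2 fun v ↦ ?_
  have hs := contMDiffOn_symm_of_mem_maximalAtlas he
  have hvec : ∀ u : E, ContMDiffOn 𝓘(ℝ, E) (𝓘(ℝ, E).prod 𝓘(ℝ, E)) ∞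
      (fun y ↦ Bundle.TotalSpace.mk' E (E := TangentSpace 𝓘(ℝ, E)) (e.symm y) (chartVector e y u))
      e.target := by
    intro u
    have h1 := hs.contMDiffOn_tangentMapWithin (m := ∞) (by simp) e.open_target.uniqueMDiffOn
    have h2 : ContMDiffOn 𝓘(ℝ, E) 𝓘(ℝ, E).tangent ∞
        (fun y : E ↦ (⟨y, u⟩ : TangentBundle 𝓘(ℝ, E) E)) e.target :=
      contMDiffOn_vectorSpace_iff_contDiffOn.2 contDiffOn_const
    refine (h1.comp h2 fun y hy ↦ hy).congr fun y hy ↦ ?_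
    simp only [Function.comp, tangentMapWithin]
    rw [mfderivWithin_of_isOpen e.open_target hy]
    rfl
  have h := ContMDiffOn.clm_bundle_apply₂ (F₁ := E) (F₂ := E) (F₃ := ℝ)
    (E₃ := Bundle.Trivial M ℝ) (b := e.symm) (ψ := fun y ↦ g.inner (e.symm y))
    (g.contMDiff.comp_contMDiffOn hs) (hvec u) (hvec v)
  intro y hy
  have h' := h y hy
  simp only [Bundle.contMDiffWithinAt_totalSpace] at h'
  exact h'.2.contDiffWithinAt

end PseudoRiemannianMetric

/-! ### Christoffel symbols: smoothness and change of charts -/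

namespace PseudoRiemannianMetric

set_option maxSynthPendingDepth 3

variable {E : Type*} [NormedAddCommGroup E] [NormedSpace ℝ E] [FiniteDimensional ℝ E]
  {M : Type*} [TopologicalSpace M] [ChartedSpace E M] [IsManifold 𝓘(ℝ, E) ∞ M]
  (g : PseudoRiemannianMetric E M) {e e' : OpenPartialHomeomorph M E}

/-- Nondegeneracy is injectivity into the dual, which has the same dimension. This makes `inverse`
in `christoffel` a genuine inverse rather than its default value. -/
theorem isInvertible_chartMetric (he : e ∈ IsManifold.maximalAtlas 𝓘(ℝ, E) ∞ M) {y : E}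
    (hy : y ∈ e.target) : (g.chartMetric e y).IsInvertible := by
  have hinj : Function.Injective (g.chartMetric e y : E →ₗ[ℝ] E →L[ℝ] ℝ) := by
    refine (injective_iff_map_eq_zero _).2 fun u hu ↦ g.eq_zero_of_chartMetric he hy fun v ↦ ?_
    exact DFunLike.congr_fun hu v
  have hrank : Module.finrank ℝ E = Module.finrank ℝ (E →L[ℝ] ℝ) := by
    rw [← (LinearMap.toContinuousLinearMap (𝕜 := ℝ) (E := E) (F' := ℝ)).finrank_eq]
    exact (Subspace.dual_finrank_eq (K := ℝ) (V := E)).symm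
  refine ⟨(LinearEquiv.ofInjectiveOfFinrankEq _ hinj hrank).toContinuousLinearEquiv, ?_⟩
  ext u v
  rfl

/-- The Christoffel symbols in the chart `e` at `y`, as a continuous bilinear map. -/
noncomputable def christoffelForm (e : OpenPartialHomeomorph M E) (y : E) : E →L[ℝ] E →L[ℝ] E :=
  let D := fderiv ℝ (g.chartMetric e) y
  (ContinuousLinearMap.compL ℝ E (E →L[ℝ] ℝ) E (g.chartMetric e y).inverse) ∘L
    ((1 / 2 : ℝ) • (D + D.flip -
      ((ContinuousLinearMap.flipₗᵢ ℝ E E ℝ).toContinuousLinearEquiv :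
        (E →L[ℝ] E →L[ℝ] ℝ) →L[ℝ] (E →L[ℝ] E →L[ℝ] ℝ)) ∘L D.flip))

omit [FiniteDimensional ℝ E] in
theorem christoffelForm_apply (e : OpenPartialHomeomorph M E) (y u v : E) :
    g.christoffelForm e y u v = g.christoffel e y u v :=
  rfl

theorem contDiffOn_christoffelForm (he : e ∈ IsManifold.maximalAtlas 𝓘(ℝ, E) ∞ M) :
    ContDiffOn ℝ ∞ (g.christoffelForm e) e.target := by
  have : CompleteSpace E := FiniteDimensional.complete ℝ E
  intro y hy
  have hg : ContDiffAt ℝ ∞ (g.chartMetric e) y :=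
    (g.contDiffOn_chartMetric he).contDiffAt (e.open_target.mem_nhds hy)
  have hD : ContDiffAt ℝ ∞ (fderiv ℝ (g.chartMetric e)) y := hg.fderiv_right (by simp)
  have hinv : ContDiffAt ℝ ∞ (fun z ↦ (g.chartMetric e z).inverse) y :=
    (g.isInvertible_chartMetric he hy).contDiffAt_map_inverse.comp y hg
  have hflip : ContDiffAt ℝ ∞ (fun z ↦ (fderiv ℝ (g.chartMetric e) z).flip) y :=
    (ContinuousLinearMap.flipₗᵢ ℝ E E (E →L[ℝ] ℝ)).contDiff.contDiffAt.comp y hD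
  refine ContDiffAt.contDiffWithinAt ?_
  refine .clm_comp ((ContinuousLinearMap.contDiff _).contDiffAt.comp y hinv) ?_
  exact (ContDiffAt.const_smul (1 / 2 : ℝ) ((hD.add hflip).sub (contDiffAt_const.clm_comp hflip)))

theorem fderiv_christoffel (he : e ∈ IsManifold.maximalAtlas 𝓘(ℝ, E) ∞ M) {y : E}
    (hy : y ∈ e.target) (u v w : E) :
    fderiv ℝ (fun z ↦ g.christoffel e z v w) y u = fderiv ℝ (g.christoffelForm e) y u v w := by
  have hd : DifferentiableAt ℝ (g.christoffelForm e) y :=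
    ((g.contDiffOn_christoffelForm he).contDiffAt (e.open_target.mem_nhds hy)).differentiableAt
      (by simp)
  have h := (hd.hasFDerivAt.clm_apply (hasFDerivAt_const v y)).clm_apply (hasFDerivAt_const w y)
  simp only [g.christoffelForm_apply] at h
  rw [h.fderiv]
  simp

/-- Lowering the index eliminates `inverse`; the transformation law is derived from this identity
alone, without differentiating an inverse. -/
theorem chartMetric_christoffel (he : e ∈ IsManifold.maximalAtlas 𝓘(ℝ, E) ∞ M) {y : E}
    (hy : y ∈ e.target) (u v w : E) :
    2 * g.chartMetric e y (g.christoffel e y u v) w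
      = fderiv ℝ (g.chartMetric e) y u v w + fderiv ℝ (g.chartMetric e) y v u w
        - fderiv ℝ (g.chartMetric e) y w u v := by
  rw [christoffel, (g.isInvertible_chartMetric he hy).self_apply_inverse]
  simp

/-- The transformation law of the Christoffel symbols under a change of charts. -/
theorem christoffel_change (he : e ∈ IsManifold.maximalAtlas 𝓘(ℝ, E) ∞ M)
    (he' : e' ∈ IsManifold.maximalAtlas 𝓘(ℝ, E) ∞ M) {y : E} (hy : y ∈ e.target)
    (hy' : e.symm y ∈ e'.source) (u v : E) :
    fderiv ℝ (fun y ↦ e' (e.symm y)) y (g.christoffel e y u v)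
      = g.christoffel e' (e' (e.symm y)) (fderiv ℝ (fun y ↦ e' (e.symm y)) y u)
          (fderiv ℝ (fun y ↦ e' (e.symm y)) y v)
        + fderiv ℝ (fderiv ℝ (fun y ↦ e' (e.symm y))) y u v := by
  set φ : E → E := fun y ↦ e' (e.symm y) with hφ
  set s := e.target ∩ e.symm ⁻¹' e'.source with hs
  have hso : IsOpen s := e.isOpen_inter_preimage_symm e'.open_source
  have hys : s ∈ 𝓝 y := hso.mem_nhds ⟨hy, hy'⟩
  have hφc : ContDiffAt ℝ ∞ φ y := (contDiffOn_transition he he').contDiffAt hys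
  have hφd : HasFDerivAt φ (fderiv ℝ φ y) y := (hφc.differentiableAt (by simp)).hasFDerivAt
  have hφd2 : HasFDerivAt (fderiv ℝ φ) (fderiv ℝ (fderiv ℝ φ) y) y :=
    ((hφc.fderiv_right (m := ∞) (by simp)).differentiableAt (by simp)).hasFDerivAt
  have hsymm : ∀ a b, fderiv ℝ (fderiv ℝ φ) y a b = fderiv ℝ (fderiv ℝ φ) y b a := by
    refine second_derivative_symmetric_of_eventually (f := φ) ?_ hφd2
    filter_upwards [hys] with z hz
    exact (((contDiffOn_transition he he').contDiffAt (hso.mem_nhds hz)).differentiableAt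
      (by simp)).hasFDerivAt
  have hz : φ y ∈ e'.target := e'.map_source hy'
  have hg : HasFDerivAt (g.chartMetric e) (fderiv ℝ (g.chartMetric e) y) y :=
    (((g.contDiffOn_chartMetric he).contDiffAt (e.open_target.mem_nhds hy)).differentiableAt
      (by simp)).hasFDerivAt
  have hg' : HasFDerivAt (g.chartMetric e') (fderiv ℝ (g.chartMetric e') (φ y)) (φ y) :=
    (((g.contDiffOn_chartMetric he').contDiffAt (e'.open_target.mem_nhds hz)).differentiableAt
      (by simp)).hasFDerivAt
  -- Differentiating the pullback formula for the metric brings in the second derivative of the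
  -- transition map.
  have hD : ∀ a b c, fderiv ℝ (g.chartMetric e) y a b c
      = fderiv ℝ (g.chartMetric e') (φ y) (fderiv ℝ φ y a) (fderiv ℝ φ y b) (fderiv ℝ φ y c)
        + g.chartMetric e' (φ y) (fderiv ℝ (fderiv ℝ φ) y a b) (fderiv ℝ φ y c)
        + g.chartMetric e' (φ y) (fderiv ℝ φ y b) (fderiv ℝ (fderiv ℝ φ) y a c) := by
    intro a b c
    have h1 := (hg.clm_apply (hasFDerivAt_const b y)).clm_apply (hasFDerivAt_const c y)
    have h2 := ((hg'.comp y hφd).clm_apply (hφd2.clm_apply (hasFDerivAt_const b y))).clm_apply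
      (hφd2.clm_apply (hasFDerivAt_const c y))
    have h3 := h1.unique (h2.congr_of_eventuallyEq (by
      filter_upwards [hys] with z hz
      exact g.chartMetric_change he he' hz.1 hz.2 b c))
    have := DFunLike.congr_fun h3 a
    simp at this
    linarith
  have hP : Function.Surjective (fderiv ℝ φ y) := by
    intro b
    obtain ⟨v, rfl⟩ := chartCoord_surjective he' hy' b
    refine ⟨chartCoord e (e.symm y) v, ?_⟩
    rw [chartCoord_change he he' (e.map_target hy) hy', e.right_inv hy]
  rw [← sub_eq_zero]
  refine g.eq_zero_of_chartMetric he' hz fun b ↦ ?_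
  obtain ⟨w, rfl⟩ := hP b
  -- In the combination of the three derivatives the second-derivative terms cancel by symmetry,
  -- except for twice the pairing of `D²φ(u, v)` with `Dφ w`.
  have k1 := g.chartMetric_christoffel he hy u v w
  have k2 := g.chartMetric_christoffel he' hz (fderiv ℝ φ y u) (fderiv ℝ φ y v) (fderiv ℝ φ y w)
  rw [g.chartMetric_change he he' hy hy', hD, hD, hD] at k1
  have s1 := g.chartMetric_symm e' (φ y) (fderiv ℝ φ y v) (fderiv ℝ (fderiv ℝ φ) y u w)
  rw [hsymm v u, hsymm w u, hsymm w v] at k1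
  simp only [map_sub, map_add, sub_apply, add_apply]
  linarith

end PseudoRiemannianMetric

/-! ### Existence and uniqueness of parallel transport -/

namespace PseudoRiemannianMetric

set_option maxSynthPendingDepth 3

variable {E : Type*} [NormedAddCommGroup E] [NormedSpace ℝ E] [FiniteDimensional ℝ E]
  {M : Type*} [TopologicalSpace M] [ChartedSpace E M] [IsManifold 𝓘(ℝ, E) ∞ M]
  (g : PseudoRiemannianMetric E M) {e e' : OpenPartialHomeomorph M E} {γ : ℝ → M}

omit [FiniteDimensional ℝ E] [IsManifold 𝓘(ℝ, E) ∞ M] in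
theorem contDiffWithinAt_chart_comp (hγ : ContMDiffOn 𝓘(ℝ, ℝ) 𝓘(ℝ, E) ∞ γ (Icc 0 1))
    (he : e ∈ IsManifold.maximalAtlas 𝓘(ℝ, E) ∞ M) {t : ℝ} (ht : t ∈ Icc (0 : ℝ) 1)
    (hte : γ t ∈ e.source) : ContDiffWithinAt ℝ ∞ (fun s ↦ e (γ s)) (Icc 0 1) t :=
  ((contMDiffAt_of_mem_maximalAtlas he hte).comp_contMDiffWithinAt t (hγ t ht)).contDiffWithinAt

/-- The vector field `V` is parallel along the restriction of the curve `γ` to `[a, b]`. -/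
def IsParallelOn (γ : ℝ → M) (V : ∀ t, TangentSpace 𝓘(ℝ, E) (γ t)) (a b : ℝ) : Prop :=
  ∀ t ∈ Icc a b, ∀ e ∈ IsManifold.maximalAtlas 𝓘(ℝ, E) ∞ M, γ t ∈ e.source →
    HasDerivWithinAt (fun s ↦ chartCoord e (γ s) (V s))
      (-(g.christoffel e (e (γ t)) (derivWithin (fun s ↦ e (γ s)) (Icc 0 1) t)
        (chartCoord e (γ t) (V t)))) (Icc a b) t

/-- The equation of parallel transport at a time `t` does not depend on the chart. -/
theorem hasDerivWithinAt_chartCoord_change (hγ : ContMDiffOn 𝓘(ℝ, ℝ) 𝓘(ℝ, E) ∞ γ (Icc 0 1))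
    (he : e ∈ IsManifold.maximalAtlas 𝓘(ℝ, E) ∞ M) (he' : e' ∈ IsManifold.maximalAtlas 𝓘(ℝ, E) ∞ M)
    {S : Set ℝ} (hS : S ⊆ Icc 0 1) {t : ℝ} (ht : t ∈ S) (hte : γ t ∈ e.source)
    (hte' : γ t ∈ e'.source) {V : ∀ t, TangentSpace 𝓘(ℝ, E) (γ t)}
    (h : HasDerivWithinAt (fun s ↦ chartCoord e (γ s) (V s))
      (-(g.christoffel e (e (γ t)) (derivWithin (fun s ↦ e (γ s)) (Icc 0 1) t)
        (chartCoord e (γ t) (V t)))) S t) :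
    HasDerivWithinAt (fun s ↦ chartCoord e' (γ s) (V s))
      (-(g.christoffel e' (e' (γ t)) (derivWithin (fun s ↦ e' (γ s)) (Icc 0 1) t)
        (chartCoord e' (γ t) (V t)))) S t := by
  set φ : E → E := fun y ↦ e' (e.symm y) with hφ
  have ht1 := hS ht
  have hy : e (γ t) ∈ e.target := e.map_source hte
  have hy' : e.symm (e (γ t)) ∈ e'.source := by rwa [e.left_inv hte]
  have hφc : ContDiffAt ℝ ∞ φ (e (γ t)) := (contDiffOn_transition he he').contDiffAt
    ((e.isOpen_inter_preimage_symm e'.open_source).mem_nhds ⟨hy, hy'⟩)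
  have hφd2 : HasFDerivAt (fderiv ℝ φ) (fderiv ℝ (fderiv ℝ φ) (e (γ t))) (e (γ t)) :=
    ((hφc.fderiv_right (m := ∞) (by simp)).differentiableAt (by simp)).hasFDerivAt
  have hc : HasDerivWithinAt (fun s ↦ e (γ s)) (derivWithin (fun s ↦ e (γ s)) (Icc 0 1) t)
      (Icc 0 1) t :=
    ((contDiffWithinAt_chart_comp hγ he ht1 hte).differentiableWithinAt (by simp)).hasDerivWithinAt
  have hsrc : ∀ᶠ s in 𝓝[Icc 0 1] t, γ s ∈ e.source ∧ γ s ∈ e'.source :=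
    (hγ t ht1).continuousWithinAt.eventually
      ((e.open_source.inter e'.open_source).mem_nhds ⟨hte, hte'⟩)
  have hvel : derivWithin (fun s ↦ e' (γ s)) (Icc 0 1) t
      = fderiv ℝ φ (e (γ t)) (derivWithin (fun s ↦ e (γ s)) (Icc 0 1) t) := by
    refine HasDerivWithinAt.derivWithin ?_ (uniqueDiffOn_Icc_zero_one t ht1)
    refine ((hφc.differentiableAt (by simp)).hasFDerivAt.comp_hasDerivWithinAt t hc)
      |>.congr_of_eventuallyEq ?_ ?_
    · filter_upwards [hsrc] with s hs
      simp [hφ, e.left_inv hs.1]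
    · simp [hφ, e.left_inv hte]
  have hA : HasDerivWithinAt (fun s ↦ fderiv ℝ φ (e (γ s)))
      (fderiv ℝ (fderiv ℝ φ) (e (γ t)) (derivWithin (fun s ↦ e (γ s)) (Icc 0 1) t)) S t :=
    hφd2.comp_hasDerivWithinAt t (hc.mono hS)
  -- The product rule for `Dφ` applied to the coordinates of `V` produces a `D²φ` term, which
  -- cancels the inhomogeneous term of the Christoffel transformation law.
  have hmain := hA.clm_apply h
  have hchange := g.christoffel_change he he' hy hy'
    (derivWithin (fun s ↦ e (γ s)) (Icc 0 1) t) (chartCoord e (γ t) (V t))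
  have hco : ∀ s, γ s ∈ e.source → γ s ∈ e'.source → chartCoord e' (γ s) (V s)
      = fderiv ℝ φ (e (γ s)) (chartCoord e (γ s) (V s)) := fun s hs hs' ↦
    chartCoord_change he he' hs hs' _
  rw [e.left_inv hte, ← hvel, ← hco t hte hte'] at hchange
  have hval : fderiv ℝ (fderiv ℝ φ) (e (γ t)) (derivWithin (fun s ↦ e (γ s)) (Icc 0 1) t)
      (chartCoord e (γ t) (V t)) + fderiv ℝ φ (e (γ t))
        (-(g.christoffel e (e (γ t)) (derivWithin (fun s ↦ e (γ s)) (Icc 0 1) t)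
          (chartCoord e (γ t) (V t))))
      = -(g.christoffel e' (e' (γ t)) (derivWithin (fun s ↦ e' (γ s)) (Icc 0 1) t)
        (chartCoord e' (γ t) (V t))) := by
    rw [map_neg, hchange]
    abel
  rw [hval] at hmain
  refine hmain.congr_of_eventuallyEq ?_ (hco t hte hte')
  filter_upwards [nhdsWithin_mono t hS hsrc] with s hs
  exact hco s hs.1 hs.2

/-- The coefficient of the linear equation of parallel transport along `γ` in the chart `e`. -/
noncomputable def transportCoeff (e : OpenPartialHomeomorph M E) (γ : ℝ → M) (t : ℝ) : E →L[ℝ] E :=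
  -(g.christoffelForm e (e (γ t)) (derivWithin (fun s ↦ e (γ s)) (Icc 0 1) t))

theorem continuousWithinAt_transportCoeff (hγ : ContMDiffOn 𝓘(ℝ, ℝ) 𝓘(ℝ, E) ∞ γ (Icc 0 1))
    (he : e ∈ IsManifold.maximalAtlas 𝓘(ℝ, E) ∞ M) {t : ℝ} (ht : t ∈ Icc (0 : ℝ) 1)
    (hte : γ t ∈ e.source) : ContinuousWithinAt (g.transportCoeff e γ) (Icc 0 1) t := by
  have hc := contDiffWithinAt_chart_comp hγ he ht hte
  have hd : ContinuousWithinAt (fun t ↦ derivWithin (fun s ↦ e (γ s)) (Icc 0 1) t) (Icc 0 1) t :=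
    (hc.fderivWithin_right uniqueDiffOn_Icc_zero_one (m := ∞) (by simp) ht).continuousWithinAt
      |>.clm_apply continuousWithinAt_const
  have hΓ : ContinuousAt (g.christoffelForm e) (e (γ t)) :=
    ((g.contDiffOn_christoffelForm he).contDiffAt
      (e.open_target.mem_nhds (e.map_source hte))).continuousAt
  exact ((hΓ.comp_continuousWithinAt (f := fun s ↦ e (γ s)) hc.continuousWithinAt).clm_apply hd).neg

/-- By chart independence, a single chart covering the piece suffices; there the condition is a
linear ODE. -/
theorem isParallelOn_iff (hγ : ContMDiffOn 𝓘(ℝ, ℝ) 𝓘(ℝ, E) ∞ γ (Icc 0 1))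
    (he : e ∈ IsManifold.maximalAtlas 𝓘(ℝ, E) ∞ M) {a b : ℝ} (hab : Icc a b ⊆ Icc 0 1)
    (hs : ∀ t ∈ Icc a b, γ t ∈ e.source) {V : ∀ t, TangentSpace 𝓘(ℝ, E) (γ t)} :
    g.IsParallelOn γ V a b ↔ ∀ t ∈ Icc a b, HasDerivWithinAt (fun s ↦ chartCoord e (γ s) (V s))
      (g.transportCoeff e γ t (chartCoord e (γ t) (V t))) (Icc a b) t :=
  ⟨fun h t ht ↦ h t ht e he (hs t ht), fun h t ht _ he' hte' ↦
    g.hasDerivWithinAt_chartCoord_change hγ he he' hab ht (hs t ht) hte' (h t ht)⟩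

/-- Parallel transport exists and is unique along short pieces of a smooth curve. -/
theorem exists_isOpen_transport (hγ : ContMDiffOn 𝓘(ℝ, ℝ) 𝓘(ℝ, E) ∞ γ (Icc 0 1)) {t₀ : ℝ}
    (ht₀ : t₀ ∈ Icc (0 : ℝ) 1) :
    ∃ U : Set ℝ, IsOpen U ∧ t₀ ∈ U ∧ ∀ a b, a ≤ b → Icc a b ⊆ Icc 0 1 → Icc a b ⊆ U →
      (∀ v : TangentSpace 𝓘(ℝ, E) (γ a), ∃ V : ∀ t, TangentSpace 𝓘(ℝ, E) (γ t),
        V a = v ∧ g.IsParallelOn γ V a b) ∧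
      ∀ V V' : ∀ t, TangentSpace 𝓘(ℝ, E) (γ t), g.IsParallelOn γ V a b → g.IsParallelOn γ V' a b →
        V a = V' a → V b = V' b := by
  have : CompleteSpace E := FiniteDimensional.complete ℝ E
  set e := chartAt E (γ t₀)
  have he : e ∈ IsManifold.maximalAtlas 𝓘(ℝ, E) ∞ M := IsManifold.chart_mem_maximalAtlas _
  have hte : γ t₀ ∈ e.source := mem_chart_source E _
  set A := g.transportCoeff e γ
  set C := ‖A t₀‖ + 1
  have hC : 0 < C := by positivity
  have hev : ∀ᶠ t in 𝓝[Icc 0 1] t₀, γ t ∈ e.source ∧ ‖A t‖ < C :=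
    ((hγ t₀ ht₀).continuousWithinAt.eventually (e.open_source.mem_nhds hte)).and
      ((g.continuousWithinAt_transportCoeff hγ he ht₀ hte).norm.eventually
        (gt_mem_nhds (lt_add_one _)))
  obtain ⟨δ, hδ, hball⟩ := Metric.mem_nhdsWithin_iff.1 hev
  -- An interval inside the ball of radius `η` has length at most `2 * η`, so `4 * C * η ≤ 1` is the
  -- smallness that the linear ODE needs.
  set η := min δ (1 / (4 * C))
  have hη : 0 < η := by positivity
  have hηC : 4 * C * η ≤ 1 := by
    have : η ≤ 1 / (4 * C) := min_le_right _ _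
    rw [le_div_iff₀ (by positivity)] at this
    linarith
  refine ⟨Metric.ball t₀ η, Metric.isOpen_ball, Metric.mem_ball_self hη,
    fun a b hab h01 hU ↦ ?_⟩
  have hin : ∀ t ∈ Icc a b, γ t ∈ e.source ∧ ‖A t‖ < C := fun t ht ↦
    hball ⟨Metric.ball_subset_ball (min_le_left _ _) (hU ht), h01 ht⟩
  have hlen : b - a ≤ 2 * η := by
    have h1 := hU (left_mem_Icc.2 hab)
    have h2 := hU (right_mem_Icc.2 hab)
    rw [Metric.mem_ball, Real.dist_eq, abs_lt] at h1 h2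
    linarith
  have hA : ContinuousOn A (Icc a b) := fun t ht ↦
    (g.continuousWithinAt_transportCoeff hγ he (h01 ht) (hin t ht).1).mono h01
  have hiff := @isParallelOn_iff _ _ _ _ _ _ _ _ g e γ hγ he a b h01 fun t ht ↦ (hin t ht).1
  constructor
  · intro v
    obtain ⟨ξ, hξa, hξ⟩ := exists_hasDerivWithinAt_linear hab hC.le hA
      (fun t ht ↦ (hin t ht).2.le) (by nlinarith) (chartCoord e (γ a) v)
    have hex : ∀ t, ∃ w : TangentSpace 𝓘(ℝ, E) (γ t),
        t ∈ Icc a b → chartCoord e (γ t) w = ξ t := by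
      intro t
      by_cases ht : t ∈ Icc a b
      · obtain ⟨w, hw⟩ := chartCoord_surjective he (hin t ht).1 (ξ t)
        exact ⟨w, fun _ ↦ hw⟩
      · exact ⟨0, fun h ↦ absurd h ht⟩
    choose V hV using hex
    have ha := left_mem_Icc.2 hab
    refine ⟨V, chartCoord_injective he (hin a ha).1 ((hV a ha).trans hξa), hiff.2 fun t ht ↦ ?_⟩
    rw [hV t ht]
    exact (hξ t ht).congr hV (hV t ht)
  · intro V V' hV hV' h
    have hb := right_mem_Icc.2 hab
    exact chartCoord_injective he (hin b hb).1
      (eqOn_of_hasDerivWithinAt_linear (fun t ht ↦ (hin t ht).2.le) (by simp only [h])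
        (hiff.1 hV) (hiff.1 hV') hb)

variable {g}

omit [FiniteDimensional ℝ E] in
theorem IsParallelOn.mono {V : ∀ t, TangentSpace 𝓘(ℝ, E) (γ t)} {a b a' b' : ℝ}
    (h : g.IsParallelOn γ V a b) (hs : Icc a' b' ⊆ Icc a b) : g.IsParallelOn γ V a' b' :=
  fun t ht e he hte ↦ (h t (hs ht) e he hte).mono hs

omit [FiniteDimensional ℝ E] in
theorem IsParallelOn.trans {V V' : ∀ t, TangentSpace 𝓘(ℝ, E) (γ t)} {a b c : ℝ} (hab : a ≤ b)
    (hbc : b ≤ c) (h : g.IsParallelOn γ V a b) (h' : g.IsParallelOn γ V' b c) (hV : V b = V' b) :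
    g.IsParallelOn γ (fun t ↦ if t ≤ b then V t else V' t) a c := by
  intro t ht e he hte
  have e1 : ∀ s ∈ Icc a b, (if s ≤ b then V s else V' s) = V s := fun s hs ↦ if_pos hs.2
  have e2 : ∀ s ∈ Icc b c, (if s ≤ b then V s else V' s) = V' s := fun s hs ↦ by
    rcases hs.1.eq_or_lt with rfl | hlt
    · simpa using hV
    · exact if_neg hlt.not_ge
  rw [← Icc_union_Icc_eq_Icc hab hbc]
  -- Both pieces contribute at `t = b`; a closed piece not containing `t` imposes no condition.
  refine HasDerivWithinAt.union ?_ ?_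
  · by_cases h1 : t ∈ Icc a b
    · beta_reduce; rw [e1 t h1]
      exact (h t h1 e he hte).congr (fun s hs ↦ by rw [e1 s hs]) (by rw [e1 t h1])
    · exact HasFDerivWithinAt.of_notMem_closure (by rwa [closure_Icc])
  · by_cases h1 : t ∈ Icc b c
    · beta_reduce; rw [e2 t h1]
      exact (h' t h1 e he hte).congr (fun s hs ↦ by rw [e2 s hs]) (by rw [e2 t h1])
    · exact HasFDerivWithinAt.of_notMem_closure (by rwa [closure_Icc])

variable (g)

/-- Existence and uniqueness of parallel transport along a smooth curve. -/
theorem exists_unique_transport (hγ : ContMDiffOn 𝓘(ℝ, ℝ) 𝓘(ℝ, E) ∞ γ (Icc 0 1)) :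
    (∀ v : TangentSpace 𝓘(ℝ, E) (γ 0), ∃ V : ∀ t, TangentSpace 𝓘(ℝ, E) (γ t),
      V 0 = v ∧ g.IsParallelAlong γ V) ∧
    ∀ V V' : ∀ t, TangentSpace 𝓘(ℝ, E) (γ t), g.IsParallelAlong γ V → g.IsParallelAlong γ V' →
      V 0 = V' 0 → V 1 = V' 1 := by
  choose U hUo hU hUV using fun t : unitInterval ↦ g.exists_isOpen_transport hγ t.2
  -- A Lebesgue number subdivision of `[0, 1]`; `τ` reaches `1` at some `N`, and induction on the
  -- pieces does the gluing.
  obtain ⟨τ, hτ0, hτm, ⟨N, hN⟩, hτ⟩ := exists_monotone_Icc_subset_open_cover_unitInterval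
    (c := fun t ↦ Subtype.val ⁻¹' U t) (fun t ↦ (hUo t).preimage continuous_subtype_val)
    (fun t _ ↦ mem_iUnion.2 ⟨t, hU t⟩)
  have hstep : ∀ n, (τ n : ℝ) ≤ τ (n + 1) := fun n ↦ hτm n.le_succ
  have hsub : ∀ n, Icc (τ n : ℝ) (τ (n + 1)) ⊆ Icc 0 1 := fun n ↦
    Icc_subset_Icc (τ n).2.1 (τ (n + 1)).2.2
  have hpiece := fun n ↦ (hUV (hτ n).choose) (τ n) (τ (n + 1)) (hstep n) (hsub n)
    fun t ht ↦ (hτ n).choose_spec (a := ⟨t, hsub n ht⟩) ht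
  have key : ∀ n, (∀ v : TangentSpace 𝓘(ℝ, E) (γ 0), ∃ V : ∀ t, TangentSpace 𝓘(ℝ, E) (γ t),
      V 0 = v ∧ g.IsParallelOn γ V 0 (τ n)) ∧
      ∀ V V' : ∀ t, TangentSpace 𝓘(ℝ, E) (γ t), g.IsParallelOn γ V 0 (τ n) →
        g.IsParallelOn γ V' 0 (τ n) → V 0 = V' 0 → V (τ n) = V' (τ n) := by
    intro n
    induction n with
    | zero =>
      rw [hτ0]
      refine ⟨fun v ↦ ?_, fun V V' _ _ h ↦ h⟩
      -- The interval is the single point `0`, so the equation is vacuous and only the value at `0`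
      -- matters.
      refine ⟨fun t ↦ if h : t = 0 then h ▸ v else 0, by simp, fun t ht e _ _ ↦ ?_⟩
      obtain rfl : t = 0 := le_antisymm ht.2 ht.1
      exact HasFDerivWithinAt.of_subsingleton (by simp)
    | succ n ih =>
      have h0 : (0 : ℝ) ≤ τ n := (τ n).2.1
      constructor
      · intro v
        obtain ⟨V, hV0, hV⟩ := ih.1 v
        obtain ⟨V', hV'0, hV'⟩ := (hpiece n).1 (V (τ n))
        exact ⟨_, by simp [h0, hV0], hV.trans h0 (hstep n) hV' hV'0.symm⟩
      · intro V V' hV hV' h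
        have hl : Icc (0 : ℝ) (τ n) ⊆ Icc 0 (τ (n + 1)) := Icc_subset_Icc_right (hstep n)
        have hr : Icc (τ n : ℝ) (τ (n + 1)) ⊆ Icc 0 (τ (n + 1)) := Icc_subset_Icc_left h0
        exact (hpiece n).2 V V' (hV.mono hr) (hV'.mono hr) (ih.2 V V' (hV.mono hl) (hV'.mono hl) h)
  have := key N
  rw [hN N le_rfl] at this
  exact this

theorem existsUnique_isCurveTransport {p q : M} (γ : SmoothCurve E p q)
    (v : TangentSpace 𝓘(ℝ, E) p) : ∃! w, g.IsCurveTransport γ v w := by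
  obtain ⟨γ, hγ, rfl, rfl⟩ := γ
  obtain ⟨hex, huniq⟩ := g.exists_unique_transport hγ
  obtain ⟨V, hV0, hV⟩ := hex v
  refine ⟨V 1, ⟨V, hV, congrArg _ hV0, rfl⟩, ?_⟩
  rintro w ⟨V', hV', h0, h1⟩
  have h0' : V' 0 = v := eq_of_heq (Bundle.TotalSpace.mk.inj h0).2
  have h1' : V' 1 = w := eq_of_heq (Bundle.TotalSpace.mk.inj h1).2
  rw [← h1']
  exact huniq V' V hV' hV (h0'.trans hV0.symm)

theorem existsUnique_isParallelTransport {p q : M} (c : PiecewiseSmoothPath E p q)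
    (v : TangentSpace 𝓘(ℝ, E) p) : ∃! w, g.IsParallelTransport c v w := by
  induction c with
  | nil p => exact ⟨v, rfl, fun w hw ↦ Eq.symm hw⟩
  | cons γ c ih =>
    obtain ⟨u, hu, huu⟩ := g.existsUnique_isCurveTransport γ v
    obtain ⟨w, hw, hwu⟩ := ih u
    refine ⟨w, ⟨u, hu, hw⟩, ?_⟩
    rintro w' ⟨u', hu', hw'⟩
    rw [huu u' hu'] at hw'
    exact hwu w' hw'

end PseudoRiemannianMetric

/-! ### Piecewise smooth paths and connected components -/

section Paths

variable {E : Type*} [NormedAddCommGroup E] [NormedSpace ℝ E]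
  {M : Type*} [TopologicalSpace M] [ChartedSpace E M]

/-- The smooth curve `γ` run backwards. -/
def SmoothCurve.reverse {p q : M} (γ : SmoothCurve E p q) : SmoothCurve E q p where
  toFun t := γ.toFun (1 - t)
  smooth := γ.smooth.comp (f := fun t : ℝ ↦ 1 - t)
    (contDiff_const.sub contDiff_id).contMDiff.contMDiffOn
    fun t ht ↦ ⟨by linarith [ht.2], by linarith [ht.1]⟩
  source := by simp [γ.target]
  target := by simp [γ.source]

/-- The concatenation of two piecewise smooth paths. -/
def PiecewiseSmoothPath.append {p q r : M} :
    PiecewiseSmoothPath E p q → PiecewiseSmoothPath E q r → PiecewiseSmoothPath E p r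
  | .nil _, d => d
  | .cons γ c, d => .cons γ (c.append d)

/-- The piecewise smooth path `c` run backwards. -/
def PiecewiseSmoothPath.reverse {p q : M} :
    PiecewiseSmoothPath E p q → PiecewiseSmoothPath E q p
  | .nil p => .nil p
  | .cons γ c => c.reverse.append (.cons γ.reverse (.nil _))

/-- The curve that is a straight segment in the coordinates of the chart `e`. -/
def SmoothCurve.segment {e : OpenPartialHomeomorph M E}
    (he : e ∈ IsManifold.maximalAtlas 𝓘(ℝ, E) ∞ M) {s : Set E} (hs : Convex ℝ s)
    (hse : s ⊆ e.target) {y z : E} (hy : y ∈ s) (hz : z ∈ s) :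
    SmoothCurve E (e.symm y) (e.symm z) where
  toFun t := e.symm (y + t • (z - y))
  smooth := (contMDiffOn_symm_of_mem_maximalAtlas he).comp
    (contDiff_const.add (contDiff_id.smul contDiff_const)).contMDiff.contMDiffOn
    fun _ ht ↦ hse (hs.add_smul_sub_mem hy hz ht)
  source := by simp
  target := by simp

/-- Being joined by a path is symmetric and transitive, and holds near each point by coordinate
segments; preconnectedness spreads it over `s`. The path may leave `s`. -/
theorem nonempty_piecewiseSmoothPath [IsManifold 𝓘(ℝ, E) ∞ M] {s : Set M} (hs : IsPreconnected s)
    {p q : M} (hp : p ∈ s) (hq : q ∈ s) : Nonempty (PiecewiseSmoothPath E p q) := by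
  refine hs.induction₂ (fun p q ↦ Nonempty (PiecewiseSmoothPath E p q)) ?_
    (fun _ _ _ _ _ _ ⟨c⟩ ⟨d⟩ ↦ ⟨c.append d⟩) (fun _ _ _ _ ⟨c⟩ ↦ ⟨c.reverse⟩) hp hq
  intro x _
  refine eventually_nhdsWithin_of_eventually_nhds ?_
  set e := chartAt E x
  have hx : x ∈ e.source := mem_chart_source E x
  obtain ⟨ρ, hρ, hball⟩ := Metric.isOpen_iff.1 e.open_target _ (e.map_source hx)
  filter_upwards [e.open_source.mem_nhds hx,
    (e.continuousAt hx).eventually (Metric.ball_mem_nhds _ hρ)] with z hz hzb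
  have c := SmoothCurve.segment (IsManifold.chart_mem_maximalAtlas x) (convex_ball _ _) hball
    (Metric.mem_ball_self hρ) hzb
  rw [e.left_inv hx, e.left_inv hz] at c
  exact ⟨.cons c (.nil _)⟩

/-- The component contains the image of a coordinate ball, which is connected and infinite. -/
theorem connectedComponent_nontrivial [Nontrivial E] (x : M) :
    (connectedComponent x).Nontrivial := by
  set e := chartAt E x
  have hx : x ∈ e.source := mem_chart_source E x
  obtain ⟨ρ, hρ, hball⟩ := Metric.isOpen_iff.1 e.open_target _ (e.map_source hx)
  have hx0 := Metric.mem_ball_self (x := e x) hρ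
  have := Module.punctured_nhds_neBot ℝ E (e x)
  have hnt : (Metric.ball (e x) ρ).Nontrivial :=
    (infinite_of_mem_nhds (e x) (Metric.ball_mem_nhds _ hρ)).nontrivial
  have himg := hnt.image_of_injOn (e.symm.injOn.mono hball)
  refine himg.mono (IsPreconnected.subset_connectedComponent
    ((convex_ball _ _).isPreconnected.image _ (e.symm.continuousOn.mono hball))
    ⟨e x, hx0, e.left_inv hx⟩)

end Paths

/-! ### Holonomy and curvature -/

namespace PseudoRiemannianMetric

set_option maxSynthPendingDepth 3

variable {E : Type*} [NormedAddCommGroup E] [NormedSpace ℝ E]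
  {M : Type*} [TopologicalSpace M] [ChartedSpace E M] [IsManifold 𝓘(ℝ, E) ∞ M]
  {g : PseudoRiemannianMetric E M} {e : OpenPartialHomeomorph M E}

/-- The substitution `t ↦ 1 - t` changes the sign of both `dV/dt` and the velocity, in which the
Christoffel term is linear. -/
theorem IsCurveTransport.reverse {p q : M} {γ : SmoothCurve E p q} {v : TangentSpace 𝓘(ℝ, E) p}
    {w : TangentSpace 𝓘(ℝ, E) q} (h : g.IsCurveTransport γ v w) :
    g.IsCurveTransport γ.reverse w v := by
  obtain ⟨V, hV, h0, h1⟩ := h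
  refine ⟨fun t ↦ V (1 - t), ?_, ?_, ?_⟩
  · intro t ht e he hte
    have ht' : 1 - t ∈ Icc (0 : ℝ) 1 := ⟨by linarith [ht.2], by linarith [ht.1]⟩
    have hmaps : MapsTo (fun t : ℝ ↦ 1 - t) (Icc 0 1) (Icc 0 1) := fun t ht ↦
      ⟨by linarith [ht.2], by linarith [ht.1]⟩
    have hd : HasDerivWithinAt (fun t : ℝ ↦ 1 - t) (-1) (Icc 0 1) t :=
      (hasDerivWithinAt_id t _).const_sub 1
    have hc : HasDerivWithinAt (fun s ↦ e (γ.toFun s))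
        (derivWithin (fun s ↦ e (γ.toFun s)) (Icc 0 1) (1 - t)) (Icc 0 1) (1 - t) :=
      ((contDiffWithinAt_chart_comp γ.smooth he ht' hte).differentiableWithinAt
        (by simp)).hasDerivWithinAt
    have hvel : derivWithin (fun s ↦ e (γ.reverse.toFun s)) (Icc 0 1) t
        = -derivWithin (fun s ↦ e (γ.toFun s)) (Icc 0 1) (1 - t) := by
      have := (hc.scomp t hd hmaps).derivWithin (uniqueDiffOn_Icc_zero_one t ht)
      rw [neg_one_smul] at this
      exact this
    have hmain := (hV (1 - t) ht' e he hte).scomp t hd hmaps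
    rw [hvel, ← g.christoffelForm_apply, map_neg, neg_apply, neg_neg]
    rw [neg_one_smul, neg_neg, ← g.christoffelForm_apply] at hmain
    exact hmain
  · rw [← h1]
    simp only [SmoothCurve.reverse]
    rw [sub_zero]
  · rw [← h0]
    simp only [SmoothCurve.reverse]
    rw [sub_self]

theorem IsParallelTransport.append {p q r : M} {c : PiecewiseSmoothPath E p q}
    {d : PiecewiseSmoothPath E q r} {v : TangentSpace 𝓘(ℝ, E) p} {u : TangentSpace 𝓘(ℝ, E) q}
    {w : TangentSpace 𝓘(ℝ, E) r} (hc : g.IsParallelTransport c v u)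
    (hd : g.IsParallelTransport d u w) : g.IsParallelTransport (c.append d) v w := by
  induction c with
  | nil p =>
    obtain rfl : v = u := hc
    exact hd
  | cons γ c ih =>
    obtain ⟨a, ha, hc⟩ := hc
    exact ⟨a, ha, ih hc hd⟩

theorem IsParallelTransport.reverse {p q : M} {c : PiecewiseSmoothPath E p q}
    {v : TangentSpace 𝓘(ℝ, E) p} {w : TangentSpace 𝓘(ℝ, E) q}
    (hc : g.IsParallelTransport c v w) : g.IsParallelTransport c.reverse w v := by
  induction c with
  | nil p => exact Eq.symm hc
  | cons γ c ih =>
    obtain ⟨a, ha, hc⟩ := hc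
    exact (ih hc).append ⟨v, ha.reverse, rfl⟩

variable [FiniteDimensional ℝ E]

/-- Reversing the curve turns uniqueness of transport into injectivity. -/
theorem IsCurveTransport.left_unique {p q : M} {γ : SmoothCurve E p q}
    {v v' : TangentSpace 𝓘(ℝ, E) p} {w : TangentSpace 𝓘(ℝ, E) q} (h : g.IsCurveTransport γ v w)
    (h' : g.IsCurveTransport γ v' w) : v = v' :=
  (g.existsUnique_isCurveTransport γ.reverse w).unique h.reverse h'.reverse

theorem IsParallelTransport.left_unique {p q : M} {c : PiecewiseSmoothPath E p q}
    {v v' : TangentSpace 𝓘(ℝ, E) p} {w : TangentSpace 𝓘(ℝ, E) q}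
    (h : g.IsParallelTransport c v w) (h' : g.IsParallelTransport c v' w) : v = v' :=
  (g.existsUnique_isParallelTransport c.reverse w).unique h.reverse h'.reverse

omit [FiniteDimensional ℝ E] in
/-- Parallel transport along a coordinate segment solves the transport equation in coordinates. -/
theorem IsCurveTransport.exists_hasDerivWithinAt_segment
    (he : e ∈ IsManifold.maximalAtlas 𝓘(ℝ, E) ∞ M) {s : Set E} (hs : Convex ℝ s)
    (hse : s ⊆ e.target) {y z : E} (hy : y ∈ s) (hz : z ∈ s)
    {v : TangentSpace 𝓘(ℝ, E) (e.symm y)} {w : TangentSpace 𝓘(ℝ, E) (e.symm z)}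
    (h : g.IsCurveTransport (SmoothCurve.segment he hs hse hy hz) v w) :
    ∃ ξ : ℝ → E, ξ 0 = chartCoord e (e.symm y) v ∧ ξ 1 = chartCoord e (e.symm z) w ∧
      ∀ t ∈ Icc (0 : ℝ) 1, HasDerivWithinAt ξ
        (-(g.christoffelForm e (y + t • (z - y)) (z - y) (ξ t))) (Icc 0 1) t := by
  set γ := SmoothCurve.segment he hs hse hy hz
  obtain ⟨V, hV, h0, h1⟩ := h
  have hγ : ∀ t ∈ Icc (0 : ℝ) 1, e (γ.toFun t) = y + t • (z - y) := fun t ht ↦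
    e.right_inv (hse (hs.add_smul_sub_mem hy hz ht))
  refine ⟨fun t ↦ chartCoord e (γ.toFun t) (V t),
    congrArg (fun p : TangentBundle 𝓘(ℝ, E) M ↦ chartCoord e p.1 p.2) h0,
    congrArg (fun p : TangentBundle 𝓘(ℝ, E) M ↦ chartCoord e p.1 p.2) h1, fun t ht ↦ ?_⟩
  have hmain := hV t ht e he (e.map_target (hse (hs.add_smul_sub_mem hy hz ht)))
  have hvel : derivWithin (fun s ↦ e (γ.toFun s)) (Icc 0 1) t = z - y := by
    refine HasDerivWithinAt.derivWithin ?_ (uniqueDiffOn_Icc_zero_one t ht)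
    have : HasDerivWithinAt (fun s : ℝ ↦ y + s • (z - y)) ((1 : ℝ) • (z - y)) (Icc 0 1) t :=
      ((hasDerivWithinAt_id t _).smul_const _).const_add y
    rw [one_smul] at this
    exact this.congr hγ (hγ t ht)
  rw [hvel, hγ t ht] at hmain
  exact hmain

/-- If parallel transport along every loop at a point is trivial, then the curvature vanishes at
this point. -/
theorem chartRiemann_eq_zero_of_trivial_holonomy (he : e ∈ IsManifold.maximalAtlas 𝓘(ℝ, E) ∞ M)
    {y₀ : E} (hy₀ : y₀ ∈ e.target)
    (hol : ∀ (c : PiecewiseSmoothPath E (e.symm y₀) (e.symm y₀))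
      (v w : TangentSpace 𝓘(ℝ, E) (e.symm y₀)), g.IsParallelTransport c v w → v = w)
    (a b c : E) : g.chartRiemann e y₀ a b c = 0 := by
  obtain ⟨ρ, hρ, hball⟩ := Metric.isOpen_iff.1 e.open_target _ hy₀
  set s := Metric.ball y₀ ρ
  have hs : Convex ℝ s := convex_ball _ _
  have h0 : y₀ ∈ s := Metric.mem_ball_self hρ
  set seg := fun {y z : E} (hy : y ∈ s) (hz : z ∈ s) ↦ SmoothCurve.segment he hs hball hy hz
  set v₀ := chartVector e y₀ c
  -- The field `W` is radial transport of `v₀` from the centre; the value `0` outside the ball plays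
  -- no role.
  have hex : ∀ y, ∃ w : TangentSpace 𝓘(ℝ, E) (e.symm y),
      ∀ hy : y ∈ s, g.IsCurveTransport (seg h0 hy) v₀ w := by
    intro y
    by_cases hy : y ∈ s
    · obtain ⟨w, hw, -⟩ := g.existsUnique_isCurveTransport (seg h0 hy) v₀
      exact ⟨w, fun _ ↦ hw⟩
    · exact ⟨0, fun h ↦ absurd h hy⟩
  choose W hW using hex
  have hWy₀ : chartCoord e (e.symm y₀) (W y₀) = c := by
    have : v₀ = W y₀ := hol (.cons (seg h0 h0) (.nil _)) _ _ ⟨W y₀, hW y₀ h0, rfl⟩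
    rw [← this, chartCoord_chartVector he hy₀]
  -- The loops `y₀ → y → z → y₀` and `y₀ → z → y₀` are both trivial, so `w` and `W z` have the same
  -- transport `v₀` back to the centre. Injectivity gives `w = W z`.
  have htri : ∀ y (hy : y ∈ s) z (hz : z ∈ s), g.IsCurveTransport (seg hy hz) (W y) (W z) := by
    intro y hy z hz
    obtain ⟨w, hw, -⟩ := g.existsUnique_isCurveTransport (seg hy hz) (W y)
    obtain ⟨u, hu, -⟩ := g.existsUnique_isCurveTransport (seg hz h0) w
    obtain ⟨u', hu', -⟩ := g.existsUnique_isCurveTransport (seg hz h0) (W z)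
    have e1 : v₀ = u := hol (.cons (seg h0 hy) (.cons (seg hy hz) (.cons (seg hz h0) (.nil _)))) _ _
      ⟨W y, hW y hy, w, hw, u, hu, rfl⟩
    have e2 : v₀ = u' := hol (.cons (seg h0 hz) (.cons (seg hz h0) (.nil _))) _ _
      ⟨W z, hW z hz, u', hu', rfl⟩
    rw [← e1] at hu
    rw [← e2] at hu'
    rwa [hu.left_unique hu'] at hw
  have hdiff : HasFDerivAt (g.christoffelForm e) (fderiv ℝ (g.christoffelForm e) y₀) y₀ :=
    (((g.contDiffOn_christoffelForm he).contDiffAt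
      (e.open_target.mem_nhds hy₀)).differentiableAt (by simp)).hasFDerivAt
  have key := curvature_apply_eq_zero_of_segment_transport
    (W := fun y ↦ chartCoord e (e.symm y) (W y)) Metric.isOpen_ball
    ((g.contDiffOn_christoffelForm he).continuousOn.mono hball)
    (fun y hy z hz ↦ (htri y hy z hz).exists_hasDerivWithinAt_segment he hs hball hy hz) h0
    hdiff a b
  rw [hWy₀] at key
  rw [chartRiemann, g.fderiv_christoffel he hy₀, g.fderiv_christoffel he hy₀]
  exact key

/-- At a point of nonzero curvature there is a loop with nontrivial holonomy. -/
theorem exists_loop_of_riemann_ne_zero {x : M} {u v w : TangentSpace 𝓘(ℝ, E) x}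
    (h : g.riemann x u v w ≠ 0) :
    ∃ (c : PiecewiseSmoothPath E x x) (v w : TangentSpace 𝓘(ℝ, E) x),
      g.IsParallelTransport c v w ∧ v ≠ w := by
  by_contra! hol
  refine h (chartRiemann_eq_zero_of_trivial_holonomy (IsManifold.chart_mem_maximalAtlas x)
    (mem_chart_target E x) ?_ _ _ _)
  rwa [(chartAt E x).left_inv (mem_chart_source E x)]

/-- Take for `v` the transport of `a` to `p`. Going back to `x` and on to `q`, without or with the
loop `ℓ` inserted, ends at the transports of `a` and `b` along `β`, which differ by injectivity. -/
theorem exists_isParallelTransport_ne {x p q : M} {ℓ : PiecewiseSmoothPath E x x}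
    {a b : TangentSpace 𝓘(ℝ, E) x} (hℓ : g.IsParallelTransport ℓ a b) (hab : a ≠ b)
    (α : PiecewiseSmoothPath E x p) (β : PiecewiseSmoothPath E x q) :
    ∃ (c c' : PiecewiseSmoothPath E p q) (v : TangentSpace 𝓘(ℝ, E) p)
      (w w' : TangentSpace 𝓘(ℝ, E) q),
      g.IsParallelTransport c v w ∧ g.IsParallelTransport c' v w' ∧ w ≠ w' := by
  obtain ⟨v, hv, -⟩ := g.existsUnique_isParallelTransport α a
  obtain ⟨w, hw, -⟩ := g.existsUnique_isParallelTransport β a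
  obtain ⟨w', hw', -⟩ := g.existsUnique_isParallelTransport β b
  exact ⟨α.reverse.append β, α.reverse.append (ℓ.append β), v, w, w', hv.reverse.append hw,
    hv.reverse.append (hℓ.append hw'), fun h ↦ hab (hw.left_unique (h ▸ hw'))⟩

end PseudoRiemannianMetric

end Transport

theorem mainTheorem1
    {E : Type*} [NormedAddCommGroup E] [NormedSpace ℝ E] [FiniteDimensional ℝ E]
    {M : Type*} [TopologicalSpace M] [ChartedSpace E M] [IsManifold 𝓘(ℝ, E) ∞ M]
    (g : PseudoRiemannianMetric E M)
    (x : M) (hx : ∃ u v w : TangentSpace 𝓘(ℝ, E) x, g.riemann x u v w ≠ 0) :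
    -- parallel transport along a given path is a well-defined map
    (∀ (p q : M) (c : PiecewiseSmoothPath E p q) (v : TangentSpace 𝓘(ℝ, E) p),
      ∃! w : TangentSpace 𝓘(ℝ, E) q, g.IsParallelTransport c v w) ∧
    -- there are different points in the connected component of the curved point `x`
    (connectedComponent x).Nontrivial ∧
    -- between any two points of that component, parallel transport depends on the path
    (∀ p ∈ connectedComponent x, ∀ q ∈ connectedComponent x,
      ∃ (c c' : PiecewiseSmoothPath E p q) (v : TangentSpace 𝓘(ℝ, E) p)
        (w w' : TangentSpace 𝓘(ℝ, E) q),
        g.IsParallelTransport c v w ∧ g.IsParallelTransport c' v w' ∧ w ≠ w') ∧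
    -- sums of tangent vectors at two points depend on the choice of paths
    (∀ p ∈ connectedComponent x, ∀ q ∈ connectedComponent x, ∀ r ∈ connectedComponent x,
      ∀ v : TangentSpace 𝓘(ℝ, E) p, ∃ (w : TangentSpace 𝓘(ℝ, E) q)
        (s s' : TangentSpace 𝓘(ℝ, E) r),
        g.IsTransportedSum v w s ∧ g.IsTransportedSum v w s' ∧ s ≠ s') := by
  obtain ⟨u, v, w, hne⟩ := hx
  obtain ⟨ℓ, a, b, hℓ, hab⟩ := PseudoRiemannianMetric.exists_loop_of_riemann_ne_zero hne
  have hpath : ∀ p ∈ connectedComponent x, ∀ q ∈ connectedComponent x,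
      Nonempty (PiecewiseSmoothPath E p q) := fun p hp q hq ↦
    nonempty_piecewiseSmoothPath isPreconnected_connectedComponent hp hq
  have hdep : ∀ p ∈ connectedComponent x, ∀ q ∈ connectedComponent x,
      ∃ (c c' : PiecewiseSmoothPath E p q) (v : TangentSpace 𝓘(ℝ, E) p)
        (w w' : TangentSpace 𝓘(ℝ, E) q),
        g.IsParallelTransport c v w ∧ g.IsParallelTransport c' v w' ∧ w ≠ w' := by
    intro p hp q hq
    obtain ⟨α⟩ := hpath x mem_connectedComponent p hp
    obtain ⟨β⟩ := hpath x mem_connectedComponent q hq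
    exact PseudoRiemannianMetric.exists_isParallelTransport_ne hℓ hab α β
  -- The nonzero curvature value and `0` are two different vectors of `E`.
  have : Nontrivial E := ⟨⟨_, _, hne⟩⟩
  refine ⟨fun p q c v ↦ g.existsUnique_isParallelTransport c v, connectedComponent_nontrivial (E := E) x,
    hdep, fun p hp q hq r hr v ↦ ?_⟩
  -- The same `α` serves both sums, so the common summand `v'` cancels; the vector `w` is chosen
  -- without regard to `v`.
  obtain ⟨α⟩ := hpath p hp r hr
  obtain ⟨v', hv', -⟩ := g.existsUnique_isParallelTransport α v
  obtain ⟨c, c', w, w₁, w₂, h₁, h₂, hne'⟩ := hdep q hq r hr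
  exact ⟨w, v' + w₁, v' + w₂, ⟨α, c, v', w₁, hv', h₁, rfl⟩, ⟨α, c', v', w₂, hv', h₂, rfl⟩,
    fun h ↦ hne' (add_left_cancel h)⟩
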